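/- For $M\subseteq\mathbb N$ and a finite $u\subset\mathbb N$ put $M/u=\{n\in M: n>\max u\}$ (with $\max\emptyset=-1$) and $M/k=M/\{k\}$; for a family $\mathcal F$ of finite subsets of $\mathbb N$ put $\mathcal F_u=\{s: u\cup s\in\mathcal F,\ \max u<\min s\}$ (where $s=\emptyset$ is allowed) and $\mathcal F\upharpoonright M=\{s\in\mathcal F: s\subseteq M\}$. Uniform families on an infinite set $S\subseteq\mathbb N$ are defined by recursion: $\{\emptyset\}$ is the only $0$-uniform family on $S$; a family $\mathcal F$ of nonempty finite subsets of $S$ is $(\alpha+1)$-uniform on $S$ if $\mathcal F_{\{n\}}$ is $\alpha$-uniform on $S/n$ for all $n\in S$; for a limit ordinal $\alpha$ it is $\alpha$-uniform on $S$ if there are ordinals $\alpha_k<\alpha$ $(k\in S)$, strictly increasing in $k$ with supremum $\alpha$, such that $\mathcal F_{\{k\}}$ is $\alpha_k$-uniform on $S/k$ for all $k\in S$. The family $\mathcal F$ carries the order topology of the lexicographic order, in which $s<_{lex}t$ if and only if $\min(s\triangle t)\in s$. For a subset $A$ of a topological space let $A^{(0)}=A$, let $A^{(\alpha+1)}$ be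 the set of those points of $A^{(\alpha)}$ that are limit points of $A^{(\alpha)}$, and let $A^{(\alpha)}=\bigcap_{\beta<\alpha}A^{(\beta)}$ for limit $\alpha$; the Cantor–Bendixson (CB) index of $A$ is the least $\alpha$ with $A^{(\alpha)}=A^{(\alpha+1)}$. Let $\mathcal F$ be $\alpha$-uniform on $S$, a final segment of $\mathbb N$, with $\alpha\ge 2$, and let $t^{\mathcal F}_n$ $(n\in S)$ denote the unique member of $\mathcal F$ that is an initial segment of $\{n,n+1,\dots\}$. For $M\subseteq\mathbb N$ infinite, the set $M(\mathcal F)$ and the notion of $\mathcal F$-adequacy are defined by recursion on $\alpha$. (i) If $\alpha=2$, then $M(\mathcal F)=\{n\in M: t^{\mathcal F}_{n+1}\subseteq M\}$, and $M$ is $\mathcal F$-adequate if $M(\mathcal F)\neq\emptyset$. (ii) If $\alpha=\beta+1$ with $\beta\ge2$, then $M(\mathcal F)$ is the set of $n\in M$ such that $t^{\mathcal F}_{n+1}\subseteq M$, $M/n$ is $\mathcal F_{\{n\}}$-adequate and $(M/n)(\mathcal F_{\{n\}})$ is infinite; $M$ is $\mathcal F$-adequate if $M(\mathcal F)\ne\emptyset$.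 (iii) If $\alpha$ is a limit, then $M(\mathcal F)=M$; and with $(\alpha_k)_{k\in S}$ the sequence from the definition of $\alpha$-uniformity, $M$ is $\mathcal F$-adequate if for every $n\in S$ there is a nonempty finite $v\subset M$ such that $\mathcal F_v$ is $\gamma$-uniform on $S/v$ for some $\gamma\ge\alpha_n$, $\gamma \geq 2$, and $M/v$ is $\mathcal F_v$-adequate. **Theorem.** Let $\mathcal F$ be an $\omega$-uniform family on a final segment $S$ of $\mathbb N$ and let $M\subseteq\mathbb N$ be infinite. Then $\mathcal F\upharpoonright M$, as a subspace of $\mathcal F$, has CB index $\omega$ if and only if $M$ is $\mathcal F$-adequate. Moreover, $M$ is $\mathcal F$-adequate if and only if $M$ contains intervals of consecutive integers of arbitrary length. -/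

import Mathlib

open Ordinal

namespace UniformFamily

/-- `M / u`: the elements of `M` that are larger than every element of the finite set `u`
(`M / k` is `tail M {k}`, and `M / ∅ = M`). -/
def tail (M : Set ℕ) (u : Finset ℕ) : Set ℕ :=
  {n | n ∈ M ∧ ∀ a ∈ u, a < n}

/-- `F_u`: the finite sets `s` with `u ∪ s ∈ F` and `max u < min s`
(no condition if `u` or `s` is empty). -/
def link (F : Set (Finset ℕ)) (u : Finset ℕ) : Set (Finset ℕ) :=
  {s | u ∪ s ∈ F ∧ ∀ a ∈ u, ∀ b ∈ s, a < b}

/-- `(a k)`, indexed by `k ∈ M`, is a strictly increasing sequence of ordinals with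
limit `α`, all of whose terms are below `α`. -/
structure IncreasesTo (M : Set ℕ) (a : ℕ → Ordinal.{0}) (α : Ordinal.{0}) : Prop where
  strictMono : StrictMonoOn a M
  lt : ∀ k ∈ M, a k < α
  cofinal : ∀ β < α, ∃ k ∈ M, β < a k

/-- `IsUniform α M F`: the family `F` of finite subsets of the infinite set `M` is
`α`-uniform on `M`. For `α > 0` the members of `F` are nonempty finite subsets of `M`. -/
inductive IsUniform : Ordinal.{0} → Set ℕ → Set (Finset ℕ) → Prop
  | zero (M : Set ℕ) : IsUniform 0 M {∅}
  | succ (α : Ordinal.{0}) (M : Set ℕ) (F : Set (Finset ℕ))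
      (hF : ∀ s ∈ F, s.Nonempty ∧ (s : Set ℕ) ⊆ M)
      (h : ∀ n ∈ M, IsUniform α (tail M {n}) (link F {n})) :
      IsUniform (Order.succ α) M F
  | limit (α : Ordinal.{0}) (hα : Order.IsSuccLimit α) (M : Set ℕ) (F : Set (Finset ℕ))
      (hF : ∀ s ∈ F, s.Nonempty ∧ (s : Set ℕ) ⊆ M)
      (a : ℕ → Ordinal.{0}) (ha : IncreasesTo M a α)
      (h : ∀ k ∈ M, IsUniform (a k) (tail M {k}) (link F {k})) :
      IsUniform α M F

/-- The lexicographic order: `s` precedes `t` iff `min (s ∆ t) ∈ s`. -/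
def LexLT (s t : Finset ℕ) : Prop :=
  ∃ a ∈ s, IsLeast {n | n ∈ symmDiff s t} a

theorem lexLT_iff (s t : Finset ℕ) :
    LexLT s t ↔ ∃ a ∈ s, a ∉ t ∧ ∀ b < a, (b ∈ s ↔ b ∈ t) := by
  constructor
  · rintro ⟨a, ha, hm, hl⟩
    simp only [Set.mem_ofPred_eq, Finset.mem_symmDiff] at hm
    refine ⟨a, ha, by tauto, fun b hb => ?_⟩
    by_contra hne
    have : b ∈ {n | n ∈ symmDiff s t} := by
      simp only [Set.mem_ofPred_eq, Finset.mem_symmDiff]; tauto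
    exact absurd (hl this) (not_le.mpr hb)
  · rintro ⟨a, ha, hat, hb⟩
    refine ⟨a, ha, by simp [Finset.mem_symmDiff, ha, hat], fun b hbm => ?_⟩
    by_contra hlt
    have := hb b (not_le.mp hlt)
    simp only [Set.mem_ofPred_eq, Finset.mem_symmDiff] at hbm
    tauto

theorem lexLT_irrefl (s : Finset ℕ) : ¬ LexLT s s := by
  rw [lexLT_iff]; rintro ⟨a, h, h', _⟩; exact h' h

theorem lexLT_trans {s t r : Finset ℕ} (h₁ : LexLT s t) (h₂ : LexLT t r) : LexLT s r := by
  rw [lexLT_iff] at *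
  obtain ⟨a, ha, hat, hab⟩ := h₁
  obtain ⟨c, hc, hcr, hcb⟩ := h₂
  rcases lt_trichotomy a c with h | h | h
  · exact ⟨a, ha, fun har => hat ((hcb a h).mpr har),
      fun b hb => (hab b hb).trans (hcb b (hb.trans h))⟩
  · subst h; exact absurd hc hat
  · exact ⟨c, (hab c h).mpr hc, hcr, fun b hb => (hab b (hb.trans h)).trans (hcb b hb)⟩

theorem lexLT_total {s t : Finset ℕ} (h : s ≠ t) : LexLT s t ∨ LexLT t s := by
  have hne : (symmDiff s t).Nonempty := by
    rw [Finset.nonempty_iff_ne_empty]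
    intro h0
    exact h (symmDiff_eq_bot.mp h0)
  have hl : IsLeast {n | n ∈ symmDiff s t} ((symmDiff s t).min' hne) :=
    Finset.isLeast_min' _ hne
  rcases Finset.mem_symmDiff.mp hl.1 with hm | hm
  · exact Or.inl ⟨_, hm.1, hl⟩
  · refine Or.inr ⟨_, hm.1, ?_⟩
    rw [symmDiff_comm t s]; exact hl

/-- The family `F` as a space of its own, ordered lexicographically. -/
structure LexSpace (F : Set (Finset ℕ)) : Type where
  val : Finset ℕ
  mem : val ∈ F

theorem LexSpace.ext' {F : Set (Finset ℕ)} {x y : LexSpace F} (h : x.val = y.val) : x = y := by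
  cases x; cases y; cases h; rfl

noncomputable instance (F : Set (Finset ℕ)) : LinearOrder (LexSpace F) where
  le x y := x = y ∨ LexLT x.val y.val
  lt x y := LexLT x.val y.val
  le_refl x := Or.inl rfl
  le_trans x y z := by
    rintro (rfl | h₁) (rfl | h₂)
    · exact Or.inl rfl
    · exact Or.inr h₂
    · exact Or.inr h₁
    · exact Or.inr (lexLT_trans h₁ h₂)
  lt_iff_le_not_ge x y := by
    constructor
    · refine fun h => ⟨Or.inr h, ?_⟩
      rintro (rfl | h')
      · exact lexLT_irrefl _ h
      · exact lexLT_irrefl _ (lexLT_trans h h')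
    · rintro ⟨rfl | h, h'⟩
      · exact absurd (Or.inl rfl) h'
      · exact h
  le_antisymm x y := by
    rintro (rfl | h₁) (h₂ | h₂)
    · rfl
    · rfl
    · exact h₂.symm
    · exact absurd (lexLT_trans h₁ h₂) (lexLT_irrefl _)
  le_total x y := by
    by_cases h : x.val = y.val
    · exact Or.inl (Or.inl (LexSpace.ext' h))
    · rcases lexLT_total h with h | h
      · exact Or.inl (Or.inr h)
      · exact Or.inr (Or.inr h)
  toDecidableLE := Classical.decRel _

/-- The order topology of the lexicographic order on `F`. -/
noncomputable instance (F : Set (Finset ℕ)) : TopologicalSpace (LexSpace F) := Preorder.topology _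

instance (F : Set (Finset ℕ)) : OrderTopology (LexSpace F) := ⟨rfl⟩

/-- `F ↾ M`, the members of `F` that are subsets of `M`, as a subset of the space `F`. -/
def restrict (F : Set (Finset ℕ)) (M : Set ℕ) : Set (LexSpace F) :=
  {x | (x.val : Set ℕ) ⊆ M}

/-- The iterated Cantor–Bendixson derivatives `A^(α)`: `A^(0) = A`, `A^(α+1)` is the set of the
points of `A^(α)` that are limit points of `A^(α)`, and intersections at limits. -/
noncomputable def cbDeriv {X : Type} [TopologicalSpace X] (A : Set X) (α : Ordinal.{0}) : Set X :=
  Ordinal.limitRecOn (motive := fun _ => Set X) α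
    A
    (fun _ B => B ∩ derivedSet B)
    (fun α _ B => ⋂ (β : Ordinal.{0}) (h : β < α), B β h)

/-- The Cantor–Bendixson index of `A` is `α`: the least ordinal with `A^(α) = A^(α+1)`. -/
def HasCBIndex {X : Type} [TopologicalSpace X] (A : Set X) (α : Ordinal.{0}) : Prop :=
  IsLeast {β : Ordinal.{0} | cbDeriv A β = cbDeriv A (Order.succ β)} α

/-- `t_n^F ⊆ M`, where `t_n^F` is the (unique) member of the front `F` that is an initial segment
of `{n, n+1, n+2, …}`. -/
def FirstSubset (F : Set (Finset ℕ)) (n : ℕ) (M : Set ℕ) : Prop :=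
  ∃ t ∈ F, (∃ m : ℕ, (t : Set ℕ) = Set.Ici n ∩ Set.Iic m) ∧ (t : Set ℕ) ⊆ M

mutual

/-- The set `M(F)`, for `F` an `α`-uniform family on `S`. It is used for `α ≥ 2` only; for
`α < 2` the value is `∅`. -/
def core (α : Ordinal.{0}) (S : Set ℕ) (F : Set (Finset ℕ)) (M : Set ℕ) : Set ℕ :=
  {n | n ∈ M ∧
    ((α = 2 ∧ FirstSubset F (n + 1) M) ∨
     (∃ (β : Ordinal.{0}) (_ : β < α), 2 ≤ β ∧ α = Order.succ β ∧ FirstSubset F (n + 1) M ∧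
        IsAdequate β (tail S {n}) (link F {n}) (tail M {n}) ∧
        (core β (tail S {n}) (link F {n}) (tail M {n})).Infinite) ∨
     Order.IsSuccLimit α)}
termination_by (α, 0)

/-- `M` is `F`-adequate, for `F` an `α`-uniform family on `S`, `α ≥ 2` (for `α < 2` it is false).
At a limit `α`, with `F_{k}` being `a k`-uniform and `a k` increasing to `α`: for every `n` there
is a nonempty finite `v ⊆ M` such that `F_v` is `γ`-uniform for some `γ ≥ a n` and `M / v` is
`F_v`-adequate. (The bound `γ < α` holds automatically when `v` is nonempty; it makes the
recursion well founded.) -/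
def IsAdequate (α : Ordinal.{0}) (S : Set ℕ) (F : Set (Finset ℕ)) (M : Set ℕ) : Prop :=
  (¬ Order.IsSuccLimit α ∧ (core α S F M).Nonempty) ∨
  (Order.IsSuccLimit α ∧ ∃ a : ℕ → Ordinal.{0}, IncreasesTo S a α ∧
    (∀ k ∈ S, IsUniform (a k) (tail S {k}) (link F {k})) ∧
    ∀ n ∈ S, ∃ v : Finset ℕ, v.Nonempty ∧ (v : Set ℕ) ⊆ M ∧
      ∃ (γ : Ordinal.{0}) (_ : γ < α), a n ≤ γ ∧
        IsUniform γ (tail S v) (link F v) ∧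
        IsAdequate γ (tail S v) (link F v) (tail M v))
termination_by (α, 1)

end

/-- `M` contains arbitrarily long intervals of consecutive integers. -/
def HasLongIntervals (M : Set ℕ) : Prop :=
  ∀ n : ℕ, ∃ k : ℕ, ∀ i < n, k + i ∈ M

end UniformFamily

namespace UniformFamily

/-! ### Uniform families of finite and of first infinite rank -/

-- A `k`-uniform family on `S` with `k` finite consists of all `k`-element subsets of `S`. Hence an
-- `ω`-uniform family on `[m, ∞)` is `sizeByMin m f` for a nondecreasing unbounded `f ≥ 1`: the size
-- of a member is a function of its minimum (`IsUniform.exists_eq_sizeByMin`). Both conditions of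
-- the theorem are compared with long intervals.
--
-- Adequacy (`isAdequate_omega0_iff`): at finite rank `k` the set `t_{n+1}` is an interval of length
-- `k`, so adequacy at unbounded ranks yields long intervals; conversely, long intervals survive
-- passing to tails and make every core of finite rank at least `2` infinite.
--
-- CB index (`hasCBIndex_restrict_sizeByMin_iff`): the rank of a point is governed by the run of
-- consecutive integers at its end. Every point has an immediate successor, so it can be approached
-- only from below. A point approached by members ending in runs of length `r + 1` ends in a run of
-- length `r + 2`; hence points of the `r`-th derivative end in runs of length at least `r + 1`
-- (`endsInInterval_of_mem_cbDeriv`), and the `ω`-th derivative is empty. The index is then `ω`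
-- exactly when no finite derivative is empty. If `M` has long intervals, the points `u ∪ [q + 1, q
-- + 1 + j]` inside `M`, with `u` nonempty and below `q ∈ M`, lie in the derivatives of order up to
-- `j` (`mem_cbDeriv_of_eq_union_Icc`), since `u ∪ {q}` can be continued arbitrarily far out by
-- points of the same kind.

theorem IsUniform.eq_singleton_empty {S : Set ℕ} {F : Set (Finset ℕ)} (h : IsUniform 0 S F) :
    F = {∅} := by
  generalize hα : (0 : Ordinal.{0}) = α at h
  cases h with
  | zero => rfl
  | succ α _ _ hF h => exact absurd hα.symm (Order.succ_ne_bot α)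
  | limit _ hl => subst hα; exact absurd hl (by simp)

theorem IsUniform.of_succ {β : Ordinal.{0}} {S : Set ℕ} {F : Set (Finset ℕ)}
    (h : IsUniform (Order.succ β) S F) :
    (∀ s ∈ F, s.Nonempty ∧ (s : Set ℕ) ⊆ S) ∧
      ∀ n ∈ S, IsUniform β (tail S {n}) (link F {n}) := by
  generalize hα : Order.succ β = α at h
  cases h with
  | zero => exact absurd hα (Order.succ_ne_bot β)
  | succ γ _ _ hF h =>
    obtain rfl := Order.succ_injective hα
    exact ⟨hF, h⟩
  | limit _ hl => subst hα; exact absurd hl (Order.not_isSuccLimit_succ β)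

theorem IsUniform.of_isSuccLimit {α : Ordinal.{0}} (hα : Order.IsSuccLimit α) {S : Set ℕ}
    {F : Set (Finset ℕ)} (h : IsUniform α S F) :
    (∀ s ∈ F, s.Nonempty ∧ (s : Set ℕ) ⊆ S) ∧ ∃ a : ℕ → Ordinal.{0}, IncreasesTo S a α ∧
      ∀ k ∈ S, IsUniform (a k) (tail S {k}) (link F {k}) := by
  cases h with
  | zero => exact absurd hα (by simp)
  | succ γ => exact absurd hα (Order.not_isSuccLimit_succ γ)
  | limit _ _ _ _ hF a ha h => exact ⟨hF, a, ha, h⟩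

theorem erase_mem_link {F : Set (Finset ℕ)} {s : Finset ℕ} {x : ℕ} (hx : x ∈ s)
    (hmin : ∀ y ∈ s, x ≤ y) : s.erase x ∈ link F {x} ↔ s ∈ F := by
  have h : {x} ∪ s.erase x = s := by
    rw [← Finset.insert_eq, Finset.insert_erase hx]
  simp only [link, Set.mem_ofPred_eq, h, and_iff_left_iff_imp]
  intro _ a ha b hb
  obtain rfl := Finset.mem_singleton.mp ha
  exact lt_of_le_of_ne (hmin b (Finset.mem_of_mem_erase hb)) (Finset.ne_of_mem_erase hb).symm

theorem exists_least {s : Finset ℕ} (hs : s.Nonempty) : ∃ x ∈ s, ∀ y ∈ s, x ≤ y :=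
  ⟨s.min' hs, s.min'_mem hs, fun y hy => s.min'_le y hy⟩

theorem erase_subset_tail {S : Set ℕ} {s : Finset ℕ} {x : ℕ} (hs : (s : Set ℕ) ⊆ S)
    (hmin : ∀ y ∈ s, x ≤ y) : ((s.erase x : Finset ℕ) : Set ℕ) ⊆ tail S {x} := by
  intro y hy
  rw [Finset.mem_coe, Finset.mem_erase] at hy
  refine ⟨hs hy.2, fun a ha => ?_⟩
  obtain rfl := Finset.mem_singleton.mp ha
  exact lt_of_le_of_ne (hmin y hy.2) hy.1.symm

/-- Induction on the rank: removing the minimum passes from the family to its link. -/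
theorem IsUniform.mem_iff_card {k : ℕ} {S : Set ℕ} {F : Set (Finset ℕ)}
    (h : IsUniform (k : Ordinal.{0}) S F) (s : Finset ℕ) :
    s ∈ F ↔ (s : Set ℕ) ⊆ S ∧ s.card = k := by
  induction k generalizing S F s with
  | zero =>
    rw [(show IsUniform 0 S F by simpa using h).eq_singleton_empty]
    simp only [Set.mem_singleton_iff, Finset.card_eq_zero]
    constructor
    · rintro rfl; simp
    · exact fun h => h.2
  | succ k ih =>
    obtain ⟨hF, hl⟩ := IsUniform.of_succ (β := (k : Ordinal.{0})) (by simpa using h)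
    constructor
    · intro hs
      obtain ⟨hne, hsub⟩ := hF s hs
      obtain ⟨x, hx, hmin⟩ := exists_least hne
      have := (ih (hl x (hsub hx)) (s.erase x)).mp ((erase_mem_link hx hmin).mpr hs)
      rw [Finset.card_erase_of_mem hx] at this
      have := Finset.card_pos.mpr hne
      exact ⟨hsub, by omega⟩
    · rintro ⟨hsub, hc⟩
      obtain ⟨x, hx, hmin⟩ := exists_least (Finset.card_pos.mp (by omega : 0 < s.card))
      refine (erase_mem_link hx hmin).mp ((ih (hl x (hsub hx)) _).mpr ⟨?_, ?_⟩)
      · exact erase_subset_tail hsub hmin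
      · rw [Finset.card_erase_of_mem hx]; omega

/-- The nonempty finite subsets of `[m, ∞)` whose size is `f` of their minimum. -/
def sizeByMin (m : ℕ) (f : ℕ → ℕ) : Set (Finset ℕ) :=
  {s | ∃ x ∈ s, (∀ y ∈ s, x ≤ y) ∧ m ≤ x ∧ s.card = f x}

theorem eq_sizeByMin {m : ℕ} {F : Set (Finset ℕ)} {b : ℕ → ℕ}
    (hF : ∀ s ∈ F, s.Nonempty ∧ (s : Set ℕ) ⊆ Set.Ici m)
    (h : ∀ k ∈ Set.Ici m, IsUniform (b k : Ordinal.{0}) (tail (Set.Ici m) {k}) (link F {k})) :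
    F = sizeByMin m (fun k => b k + 1) := by
  ext s
  constructor
  · intro hs
    obtain ⟨hne, hsub⟩ := hF s hs
    obtain ⟨x, hx, hmin⟩ := exists_least hne
    have := ((h x (hsub hx)).mem_iff_card _).mp ((erase_mem_link hx hmin).mpr hs)
    rw [Finset.card_erase_of_mem hx] at this
    have := Finset.card_pos.mpr hne
    exact ⟨x, hx, hmin, hsub hx, by dsimp only; omega⟩
  · rintro ⟨x, hx, hmin, hm, hc⟩
    dsimp only at hc
    refine (erase_mem_link hx hmin).mp (((h x hm).mem_iff_card _).mpr ⟨?_, ?_⟩)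
    · exact erase_subset_tail (fun y hy => hm.trans (hmin y hy)) hmin
    · rw [Finset.card_erase_of_mem hx]; omega

/-! ### Long intervals and adequacy -/

theorem HasLongIntervals.exists_ge {M : Set ℕ} (h : HasLongIntervals M) (n N : ℕ) :
    ∃ k ≥ N, ∀ i < n, k + i ∈ M := by
  obtain ⟨k, hk⟩ := h (N + n)
  refine ⟨k + N, by omega, fun i hi => ?_⟩
  rw [add_assoc]
  exact hk _ (by omega)

theorem HasLongIntervals.tail {M : Set ℕ} (h : HasLongIntervals M) (n : ℕ) :
    HasLongIntervals (tail M {n}) := by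
  intro l
  obtain ⟨k, hk, hi⟩ := h.exists_ge l (n + 1)
  refine ⟨k, fun i hl => ⟨hi i hl, fun a ha => ?_⟩⟩
  obtain rfl := Finset.mem_singleton.mp ha
  omega

theorem tail_Ici {m n : ℕ} (h : m ≤ n) : tail (Set.Ici m) {n} = Set.Ici (n + 1) := by
  ext x
  simp only [tail, Set.mem_ofPred_eq, Set.mem_Ici, Finset.mem_singleton, forall_eq]
  omega

theorem not_isSuccLimit_natCast (k : ℕ) : ¬ Order.IsSuccLimit (k : Ordinal.{0}) := by
  intro h
  cases k with
  | zero => simp at h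
  | succ k => simp at h

theorem firstSubset_of_interval {m k n : ℕ} {F : Set (Finset ℕ)} {M : Set ℕ}
    (hF : IsUniform (k : Ordinal.{0}) (Set.Ici m) F) (hmn : m ≤ n)
    (h : ∀ i < k + 1, n + i ∈ M) : FirstSubset F (n + 1) M := by
  refine ⟨Finset.Icc (n + 1) (n + k), (hF.mem_iff_card _).mpr ⟨?_, ?_⟩, ⟨n + k, ?_⟩, ?_⟩
  · intro y hy
    simp only [Finset.coe_Icc, Set.mem_Icc, Set.mem_Ici] at hy ⊢
    omega
  · simp
  · rw [Finset.coe_Icc]; rfl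
  · intro y hy
    simp only [Finset.coe_Icc, Set.mem_Icc] at hy
    obtain ⟨i, rfl⟩ := Nat.exists_eq_add_of_le (show n ≤ y by omega)
    exact h i (by omega)

/-- Infinitude rather than nonemptiness is what the successor clause of `core` demands of the link,
so it is the statement that carries the induction. The starting point of any interval of length `k +
1` far enough out belongs to the core. -/
theorem infinite_core {k m : ℕ} {F : Set (Finset ℕ)} {M : Set ℕ} (hM : HasLongIntervals M)
    (hk : 2 ≤ k) (hF : IsUniform (k : Ordinal.{0}) (Set.Ici m) F) :
    (core (k : Ordinal.{0}) (Set.Ici m) F M).Infinite := by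
  induction k, hk using Nat.le_induction generalizing m F M with
  | base =>
    refine Set.infinite_of_forall_exists_gt fun N => ?_
    obtain ⟨n, hn, hi⟩ := hM.exists_ge 3 (m + N + 1)
    refine ⟨n, ?_, by omega⟩
    rw [core]
    exact ⟨hi 0 (by omega), Or.inl ⟨by simp, firstSubset_of_interval hF (by omega) hi⟩⟩
  | succ k hk ih =>
    refine Set.infinite_of_forall_exists_gt fun N => ?_
    obtain ⟨n, hn, hi⟩ := hM.exists_ge (k + 2) (m + N + 1)
    refine ⟨n, ?_, by omega⟩
    have hmn : m ≤ n := by omega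
    have hl := (IsUniform.of_succ (S := Set.Ici m) (β := (k : Ordinal.{0}))
      (by simpa using hF)).2 n hmn
    rw [tail_Ici hmn] at hl
    have hc := ih (hM.tail n) hl
    rw [core]
    refine ⟨hi 0 (by omega), Or.inr (Or.inl ⟨k, by simp, by exact_mod_cast hk, by simp,
      firstSubset_of_interval hF hmn hi, ?_⟩)⟩
    rw [tail_Ici hmn]
    refine ⟨?_, hc⟩
    rw [IsAdequate]
    exact Or.inl ⟨not_isSuccLimit_natCast k, hc.nonempty⟩

/-- Only the clause on `t_{n+1}` matters: this set is an interval and, being a member, has `k`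
elements. -/
theorem IsAdequate.exists_interval {k : ℕ} {S : Set ℕ} {F : Set (Finset ℕ)} {M : Set ℕ}
    (hF : IsUniform (k : Ordinal.{0}) S F) (h : IsAdequate (k : Ordinal.{0}) S F M) :
    ∃ n, ∀ i < k, n + i ∈ M := by
  rw [IsAdequate] at h
  obtain ⟨-, n, hn⟩ | ⟨h, -⟩ := h
  swap
  · exact absurd h (not_isSuccLimit_natCast k)
  rw [core] at hn
  have hfs : FirstSubset F (n + 1) M := by
    obtain ⟨-, ⟨-, h⟩ | ⟨_, _, _, _, h, _⟩ | h⟩ := hn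
    · exact h
    · exact h
    · exact absurd h (not_isSuccLimit_natCast k)
  obtain ⟨t, ht, ⟨e, he⟩, htM⟩ := hfs
  have hte : t = Finset.Icc (n + 1) e := by
    apply Finset.coe_injective
    rw [he, Finset.coe_Icc]; rfl
  have hc := ((hF.mem_iff_card t).mp ht).2
  rw [hte, Nat.card_Icc] at hc
  refine ⟨n + 1, fun i hi => htM ?_⟩
  rw [hte, Finset.coe_Icc, Set.mem_Icc]
  omega

theorem isAdequate_omega0_iff {m : ℕ} {F : Set (Finset ℕ)}
    (hF : IsUniform ω (Set.Ici m) F) {M : Set ℕ} (hM : M.Infinite) :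
    IsAdequate ω (Set.Ici m) F M ↔ HasLongIntervals M := by
  constructor
  · intro h n
    rw [IsAdequate] at h
    obtain ⟨h, -⟩ | ⟨-, a, ha, -, h⟩ := h
    · exact absurd isSuccLimit_omega0 h
    obtain ⟨l, hl, hnl⟩ := ha.cofinal n (natCast_lt_omega0 n)
    obtain ⟨v, -, hv, γ, hγ, haγ, hu, had⟩ := h l hl
    obtain ⟨k, rfl⟩ := lt_omega0.mp hγ
    obtain ⟨p, hp⟩ := had.exists_interval hu
    have hnk : n < k := by exact_mod_cast hnl.trans_le haγ
    exact ⟨p, fun i hi => (hp i (by omega)).1⟩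
  · intro h
    obtain ⟨-, a, ha, hl⟩ := hF.of_isSuccLimit isSuccLimit_omega0
    rw [IsAdequate]
    refine Or.inr ⟨isSuccLimit_omega0, a, ha, hl, fun n hn => ?_⟩
    -- A singleton `v = {x}` with `x ∈ M` beyond `n` and `l` suffices: its rank `a x` exceeds both
    -- `a n` and `2`.
    obtain ⟨l, hlS, hl2⟩ := ha.cofinal 2 (by simpa using natCast_lt_omega0 2)
    obtain ⟨x, hxM, hx⟩ := hM.exists_gt (max n l)
    have hnx : n < x := (le_max_left _ _).trans_lt hx
    have hlx : l < x := (le_max_right _ _).trans_lt hx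
    have hmx : m ≤ x := le_trans hn hnx.le
    have hu := hl x hmx
    have hax := ha.lt x hmx
    have h2 := hl2.trans (ha.strictMono hlS hmx hlx)
    have hnx' := (ha.strictMono hn hmx hnx).le
    generalize a x = γ at hu hax h2 hnx'
    obtain ⟨k, rfl⟩ := lt_omega0.mp hax
    refine ⟨{x}, by simp, by simpa using hxM, k, hax, hnx', hu, ?_⟩
    rw [tail_Ici hmx] at hu ⊢
    rw [IsAdequate]
    exact Or.inl ⟨not_isSuccLimit_natCast k,
      (infinite_core (h.tail x) (by exact_mod_cast h2.le) hu).nonempty⟩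

/-! ### Cantor–Bendixson derivatives -/

section CantorBendixson

variable {X : Type} [TopologicalSpace X]

theorem cbDeriv_zero (A : Set X) : cbDeriv A 0 = A := by
  simp [cbDeriv]

theorem cbDeriv_succ (A : Set X) (α : Ordinal.{0}) :
    cbDeriv A (Order.succ α) = cbDeriv A α ∩ derivedSet (cbDeriv A α) := by
  simp [cbDeriv]

theorem cbDeriv_natCast_succ (A : Set X) (n : ℕ) :
    cbDeriv A ((n + 1 : ℕ) : Ordinal.{0}) = cbDeriv A n ∩ derivedSet (cbDeriv A n) := by
  rw [← cbDeriv_succ]; simp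

theorem mem_cbDeriv_omega0 {A : Set X} {x : X} :
    x ∈ cbDeriv A ω ↔ ∀ n : ℕ, x ∈ cbDeriv A n := by
  have h : cbDeriv A ω = ⋂ (β : Ordinal.{0}) (_ : β < ω), cbDeriv A β := by
    rw [cbDeriv, Ordinal.limitRecOn_limit _ _ _ _ isSuccLimit_omega0]; rfl
  rw [h]
  simp only [Set.mem_iInter]
  constructor
  · exact fun h n => h n (natCast_lt_omega0 n)
  · intro h β hβ
    obtain ⟨n, rfl⟩ := lt_omega0.mp hβ
    exact h n

theorem cbDeriv_natCast_antitone (A : Set X) : Antitone fun n : ℕ => cbDeriv A n :=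
  antitone_nat_of_succ_le fun n => by
    rw [cbDeriv_natCast_succ]; exact Set.inter_subset_left

theorem cbDeriv_omega0_eq_of_stable {A : Set X} {n : ℕ}
    (h : cbDeriv A n = cbDeriv A (n + 1 : ℕ)) : cbDeriv A ω = cbDeriv A n := by
  have hs : ∀ k : ℕ, cbDeriv A (n + k : ℕ) = cbDeriv A n := by
    intro k
    induction k with
    | zero => rfl
    | succ k ih => rw [← add_assoc, cbDeriv_natCast_succ, ih, ← cbDeriv_natCast_succ, ← h]
  ext x
  rw [mem_cbDeriv_omega0]
  refine ⟨fun hx => hx n, fun hx k => cbDeriv_natCast_antitone A (Nat.le_add_left k n) ?_⟩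
  simpa only [hs k] using hx

/-- Stabilization at a finite stage `n` would make the `n`-th derivative equal to the `ω`-th, which
is empty. -/
theorem hasCBIndex_omega0_iff {A : Set X} (hA : cbDeriv A ω = ∅) :
    HasCBIndex A ω ↔ ∀ n : ℕ, (cbDeriv A n).Nonempty := by
  constructor
  · intro h n
    by_contra hne
    rw [Set.not_nonempty_iff_eq_empty] at hne
    have : ω ≤ (n : Ordinal.{0}) := h.2 (by
      rw [Set.mem_ofPred_eq, cbDeriv_succ, hne, Set.empty_inter])
    exact absurd this (not_le.mpr (natCast_lt_omega0 n))
  · intro h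
    refine ⟨by rw [Set.mem_ofPred_eq, cbDeriv_succ, hA, Set.empty_inter], fun β hβ => ?_⟩
    by_contra hlt
    obtain ⟨n, rfl⟩ := lt_omega0.mp (not_le.mp hlt)
    have hst : cbDeriv A n = cbDeriv A (n + 1 : ℕ) := by simpa using hβ
    have := h n
    rw [← cbDeriv_omega0_eq_of_stable hst, hA] at this
    exact Set.not_nonempty_empty this

end CantorBendixson

/-! ### The lexicographic space of a family given by sizes -/

section SizeByMin

variable {m : ℕ} {f : ℕ → ℕ}

theorem LexSpace.lt_iff {F : Set (Finset ℕ)} {x y : LexSpace F} :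
    x < y ↔ ∃ a ∈ x.val, a ∉ y.val ∧ ∀ b < a, (b ∈ x.val ↔ b ∈ y.val) :=
  lexLT_iff x.val y.val

/-- Agreement up to and including a common element forces equal minima, and the minimum determines
the size. Consequently no member is a proper initial segment of another. -/
theorem card_eq_of_agree {s t : Finset ℕ} (hs : s ∈ sizeByMin m f) (ht : t ∈ sizeByMin m f)
    {c : ℕ} (hcs : c ∈ s) (hct : c ∈ t) (h : ∀ b < c, (b ∈ s ↔ b ∈ t)) : s.card = t.card := by
  obtain ⟨x, hx, hxm, -, hxc⟩ := hs
  obtain ⟨y, hy, hym, -, hyc⟩ := ht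
  have hxt : x ∈ t := by
    rcases (hxm c hcs).lt_or_eq with h' | rfl
    · exact (h x h').mp hx
    · exact hct
  have hys : y ∈ s := by
    rcases (hym c hct).lt_or_eq with h' | rfl
    · exact (h y h').mpr hy
    · exact hcs
  obtain rfl := le_antisymm (hxm y hys) (hym x hxt)
  rw [hxc, hyc]

theorem eq_of_subset_of_agree {s t : Finset ℕ} (hs : s ∈ sizeByMin m f) (ht : t ∈ sizeByMin m f)
    {c : ℕ} (hcs : c ∈ s) (hct : c ∈ t) (h : ∀ b < c, (b ∈ s ↔ b ∈ t)) (hst : s ⊆ t) : s = t :=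
  Finset.eq_of_subset_of_card_le hst (card_eq_of_agree hs ht hcs hct h).ge

/-- The part of `s` from `c` on is replaced by a run starting at `b`, of the length the size
function prescribes. When `c` is the minimum nothing is kept, so `b` is the new minimum and the
length is `f b`. -/
theorem exists_union_Icc_mem (hf : ∀ x, m ≤ x → 1 ≤ f x) {s : Finset ℕ}
    (hs : s ∈ sizeByMin m f) {c b : ℕ} (hc : c ∈ s) (hmb : m ≤ b)
    (hb : ∀ y ∈ s, y < c → y < b) :
    ∃ e ≥ b, s.filter (· < c) ∪ Finset.Icc b e ∈ sizeByMin m f := by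
  obtain ⟨x, hx, hxm, hmx, hxc⟩ := hs
  have hdisj : ∀ e, Disjoint (s.filter (· < c)) (Finset.Icc b e) := by
    intro e
    rw [Finset.disjoint_left]
    intro y hy hy'
    rw [Finset.mem_filter] at hy
    rw [Finset.mem_Icc] at hy'
    exact absurd (hb y hy.1 hy.2) (not_lt.mpr hy'.1)
  rcases (hxm c hc).lt_or_eq with hxc' | rfl
  · have hlt : (s.filter (· < c)).card < s.card :=
      Finset.card_lt_card (Finset.filter_ssubset.mpr ⟨c, hc, lt_irrefl c⟩)
    refine ⟨b + (f x - (s.filter (· < c)).card - 1), by omega, x, ?_, ?_, hmx, ?_⟩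
    · simp [hx, hxc']
    · intro y hy
      rw [Finset.mem_union, Finset.mem_filter, Finset.mem_Icc] at hy
      rcases hy with hy | hy
      · exact hxm y hy.1
      · exact (hb x hx hxc').le.trans hy.1
    · rw [Finset.card_union_of_disjoint (hdisj _), Nat.card_Icc]
      omega
  · have he : s.filter (· < x) = ∅ :=
      Finset.filter_eq_empty_iff.mpr fun y hy => not_lt.mpr (hxm y hy)
    have := hf b hmb
    refine ⟨b + (f b - 1), by omega, b, ?_, ?_, hmb, ?_⟩
    · simp
    · intro y hy
      rw [he, Finset.empty_union, Finset.mem_Icc] at hy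
      exact hy.1
    · rw [he, Finset.empty_union, Nat.card_Icc]
      omega

theorem le_of_mem_sizeByMin {s : Finset ℕ} (hs : s ∈ sizeByMin m f) {y : ℕ} (hy : y ∈ s) :
    m ≤ y := by
  obtain ⟨x, -, hx, hm, -⟩ := hs
  exact hm.trans (hx y hy)

theorem nonempty_of_mem_sizeByMin {s : Finset ℕ} (hs : s ∈ sizeByMin m f) : s.Nonempty := by
  obtain ⟨x, hx, -⟩ := hs
  exact ⟨x, hx⟩

-- Upper bound: the final run controls the rank

/-- The successor of `s` arises by replacing its maximum `e` with a run starting at `e + 1`; hence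
no point is a limit from above. -/
theorem exists_covBy (hf : ∀ x, m ≤ x → 1 ≤ f x) (s : LexSpace (sizeByMin m f)) :
    ∃ h, s ⋖ h := by
  obtain ⟨e, he, hmax⟩ : ∃ e ∈ s.val, ∀ y ∈ s.val, y ≤ e :=
    ⟨_, s.val.max'_mem (nonempty_of_mem_sizeByMin s.mem), fun y hy => s.val.le_max' y hy⟩
  obtain ⟨y, hy, hmem⟩ := exists_union_Icc_mem hf s.mem he
    ((le_of_mem_sizeByMin s.mem he).trans e.le_succ) (fun y _ hye => hye.trans e.lt_succ_self)
  have hval : ∀ b, b ∈ s.val.filter (· < e) ∪ Finset.Icc e.succ y ↔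
      (b ∈ s.val ∧ b < e) ∨ (e < b ∧ b ≤ y) := by
    intro b
    simp only [Finset.mem_union, Finset.mem_filter, Finset.mem_Icc, Nat.succ_le_iff]
  refine ⟨⟨_, hmem⟩, LexSpace.lt_iff.mpr ⟨e, he, ?_, ?_⟩, ?_⟩
  · simp only [hval]; omega
  · intro b hb
    simp only [hval]
    constructor
    · exact fun h => Or.inl ⟨h, hb⟩
    · rintro (h | h)
      · exact h.1
      · omega
  · intro z hsz hzh
    obtain ⟨d, hds, hdz, hd⟩ := LexSpace.lt_iff.mp hsz
    obtain ⟨c, hcz, hch, hc⟩ := LexSpace.lt_iff.mp hzh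
    simp only [hval] at hch hc
    have hde := hmax d hds
    have hce : e < c := by
      by_contra hce
      rcases lt_trichotomy d c with h | rfl | h
      · exact hdz ((hc d h).mpr (Or.inl ⟨hds, by omega⟩))
      · exact hdz hcz
      · exact hch (Or.inl ⟨(hd c h).mpr hcz, by omega⟩)
    have hyc : y < c := by
      by_contra h; exact hch (Or.inr ⟨hce, by omega⟩)
    have heq := eq_of_subset_of_agree (c := e.succ) hmem z.mem
      ((hval _).mpr (Or.inr ⟨e.lt_succ_self, hy⟩))
      ((hc _ (by omega)).mpr (Or.inr ⟨e.lt_succ_self, hy⟩))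
      (fun b hb => by rw [hval, hc b (by omega)])
      (fun b hb => by
        have hb' := (hval b).mp hb
        refine (hc b ?_).mpr hb'
        rcases hb' with h | h <;> omega)
    rw [← heq, hval] at hcz
    exact hch hcz

/-- `s` ends with an interval of (at least) `r + 1` consecutive integers. -/
def EndsInInterval (r : ℕ) (s : Finset ℕ) : Prop :=
  ∃ p, (∀ i ≤ r, p + i ∈ s) ∧ ∀ y ∈ s, y ≤ p + r

/-- If the final run of `s` has length exactly `r + 1` then the other members of the family that
end in a run of length at least `r + 1` do not accumulate at `s`. -/
theorem exists_nhds_eq_of_endsInInterval (hf : ∀ x, m ≤ x → 1 ≤ f x)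
    (hmono : ∀ x, m ≤ x → f x ≤ f (x + 1)) {r : ℕ} (s : LexSpace (sizeByMin m f))
    (hs : EndsInInterval r s.val) (hs' : ¬ EndsInInterval (r + 1) s.val) :
    ∃ U ∈ nhds s, ∀ z ∈ U, EndsInInterval r z.val → z = s := by
  obtain ⟨h, hsh⟩ := exists_covBy hf s
  obtain ⟨p, hp, hmax⟩ := hs
  have hps : p ∈ s.val := hp 0 (Nat.zero_le r)
  have hmp : m ≤ p := le_of_mem_sizeByMin s.mem hps
  have hIcc : ∀ c, p ≤ c → c ≤ p + r → c ∈ s.val := by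
    intro c h1 h2
    obtain ⟨i, rfl⟩ := Nat.exists_eq_add_of_le h1
    exact hp i (by omega)
  -- A point below `s` departs from it before the final run: departing after the run would make `s`
  -- a proper initial segment of `z`.
  have hbeyond : ∀ z < s, ∃ c < p, c ∈ z.val ∧ c ∉ s.val ∧ ∀ b < c, (b ∈ z.val ↔ b ∈ s.val) := by
    intro z hz
    obtain ⟨c, hcz, hcs, hc⟩ := LexSpace.lt_iff.mp hz
    refine ⟨c, ?_, hcz, hcs, hc⟩
    by_contra hpc
    have hlt : p + r < c := by
      by_contra h; exact hcs (hIcc c (by omega) (by omega))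
    have heq := eq_of_subset_of_agree s.mem z.mem hps ((hc p (by omega)).mpr hps)
      (fun b hb => (hc b (by omega)).symm)
      (fun b hb => (hc b ((hmax b hb).trans_lt hlt)).mpr hb)
    exact hcs (heq ▸ hcz)
  have hup : ∀ z < h, z ≤ s := fun z hz => not_lt.mp fun hsz => hsh.2 hsz hz
  -- If the run starts at `m`, nothing lies below `s`, so `s` is isolated.
  rcases hmp.eq_or_lt with rfl | hlt
  · refine ⟨Set.Iio h, Iio_mem_nhds hsh.1, fun z hz _ => ?_⟩
    refine (hup z hz).lt_or_eq.resolve_left fun hzs => ?_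
    obtain ⟨c, hc, hcz, -⟩ := hbeyond z hzs
    exact absurd (le_of_mem_sizeByMin z.mem hcz) (not_le.mpr hc)
  obtain ⟨q, rfl⟩ : ∃ q, p = q + 1 := ⟨p - 1, by omega⟩
  have hqs : q ∉ s.val := by
    intro hq
    refine hs' ⟨q, fun i hi => ?_, fun y hy => (hmax y hy).trans (by omega)⟩
    rcases Nat.eq_zero_or_pos i with rfl | hi0
    · exact hq
    · exact hIcc _ (by omega) (by omega)
  have hltq : ∀ y ∈ s.val, y < q + 1 → y < q := fun y hy hyq =>
    lt_of_le_of_ne (Nat.lt_succ_iff.mp hyq) (fun h => hqs (h ▸ hy))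
  -- The lower end of the neighbourhood: the final run of `s` is replaced by a run starting one step
  -- earlier, at `q`.
  obtain ⟨y, hy, hmem⟩ := exists_union_Icc_mem hf s.mem hps (Nat.lt_succ_iff.mp hlt) hltq
  have hval : ∀ b, b ∈ s.val.filter (· < q + 1) ∪ Finset.Icc q y ↔
      (b ∈ s.val ∧ b < q) ∨ (q ≤ b ∧ b ≤ y) := by
    intro b
    simp only [Finset.mem_union, Finset.mem_filter, Finset.mem_Icc]
    refine or_congr_left (and_congr_right fun hb => ⟨hltq b hb, fun h => by omega⟩)
  -- Monotonicity of `f` enters here: if `s` is a single run, its minimum `q + 1` is replaced by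
  -- `q`; otherwise the minimum is unchanged.
  have hcard : (s.val.filter (· < q + 1) ∪ Finset.Icc q y).card ≤ s.val.card := by
    have hmem' := hmem
    obtain ⟨x, hx, hxm, hmx, hxc⟩ := hmem'
    obtain ⟨x', hx', hxm', hmx', hxc'⟩ := s.mem
    rw [hxc, hxc']
    have hxq : x ≤ q := hxm q ((hval q).mpr (Or.inr ⟨le_rfl, hy⟩))
    have hxx : x ≤ x' := by
      rcases lt_or_ge x' q with h | h
      · exact hxm x' ((hval x').mpr (Or.inl ⟨hx', h⟩))
      · exact hxq.trans h
    exact Nat.rel_of_forall_rel_succ_of_le_of_le (· ≤ ·) (fun n hn => hmono n hn) hmx hxx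
  have hcards : s.val.card = (s.val.filter (· < q)).card + (r + 1) := by
    have : s.val = s.val.filter (· < q) ∪ Finset.Icc (q + 1) (q + 1 + r) := by
      ext b
      simp only [Finset.mem_union, Finset.mem_filter, Finset.mem_Icc]
      constructor
      · intro hb
        have := hmax b hb
        by_cases h : b < q
        · exact Or.inl ⟨hb, h⟩
        · have : b ≠ q := fun h => hqs (h ▸ hb)
          right; omega
      · rintro (h | h)
        · exact h.1
        · exact hIcc b h.1 h.2
    conv_lhs => rw [this]
    rw [Finset.card_union_of_disjoint, Nat.card_Icc]
    · omega
    · rw [Finset.disjoint_left]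
      intro b hb hb'
      rw [Finset.mem_filter] at hb
      rw [Finset.mem_Icc] at hb'
      omega
  have hlos : (⟨_, hmem⟩ : LexSpace (sizeByMin m f)) < s := by
    refine LexSpace.lt_iff.mpr ⟨q, (hval q).mpr (Or.inr ⟨le_rfl, hy⟩), hqs, fun b hb => ?_⟩
    simp only [hval]
    constructor
    · rintro (h | h)
      · exact h.1
      · omega
    · exact fun h => Or.inl ⟨h, hb⟩
  refine ⟨Set.Ioo ⟨_, hmem⟩ h, Ioo_mem_nhds hlos hsh.1, ?_⟩
  rintro z ⟨hloz, hzh⟩ ⟨p', hp', hmax'⟩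
  refine (hup z hzh).lt_or_eq.resolve_left fun hzs => ?_
  obtain ⟨c, hcp, hcz, hcs, hc⟩ := hbeyond z hzs
  obtain ⟨d, hdl, hdz, hd⟩ := LexSpace.lt_iff.mp hloz
  simp only [hval] at hdl hd
  -- Between the lower end and `s`, a point must agree with `s` below `q` and contain `q`.
  have hcq : c = q := by
    by_contra hne
    rcases lt_trichotomy d c with h | rfl | h
    · rcases hdl with hdl | hdl
      · exact hdz ((hc d h).mpr hdl.1)
      · omega
    · exact hdz hcz
    · rcases (hd c h).mpr hcz with h' | h'
      · exact hcs h'.1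
      · omega
  subst hcq
  have hqlo := (hval c).mpr (Or.inr ⟨le_rfl, hy⟩)
  have hagree : ∀ b < c, (b ∈ s.val.filter (· < c + 1) ∪ Finset.Icc c y ↔ b ∈ z.val) := by
    intro b hb
    rw [hval, hc b hb]
    constructor
    · rintro (h | h)
      · exact h.1
      · omega
    · exact fun h => Or.inl ⟨h, hb⟩
  have hzcard := card_eq_of_agree hmem z.mem hqlo hcz hagree
  have hcp' : c ≤ p' + r := hmax' c hcz
  -- If the final run of `z` reaches back to `q`, then `z` and the lower end are both the part of
  -- `s` below `q` followed by a run from `q`, hence equal. Otherwise `z` contains that part, `q`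
  -- and `r + 1` further elements, which is more than `s.val.card`.
  by_cases hpc : p' ≤ c
  · have hzval : ∀ b, b ∈ z.val ↔ (b ∈ s.val ∧ b < c) ∨ (c ≤ b ∧ b ≤ p' + r) := by
      intro b
      rcases lt_or_ge b c with hb | hb
      · rw [hc b hb]
        simp [hb, not_le.mpr hb]
      · simp only [not_lt.mpr hb, hb, and_false, true_and, false_or]
        refine ⟨hmax' b, fun hbr => ?_⟩
        obtain ⟨i, rfl⟩ := Nat.exists_eq_add_of_le (hpc.trans hb)
        exact hp' i (by omega)
    have heq : s.val.filter (· < c + 1) ∪ Finset.Icc c y = z.val := by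
      rcases le_total y (p' + r) with h | h
      · refine eq_of_subset_of_agree hmem z.mem hqlo hcz hagree fun b hb => ?_
        rw [hval] at hb
        rw [hzval]
        exact hb.imp_right fun h' => ⟨h'.1, h'.2.trans h⟩
      · refine (eq_of_subset_of_agree z.mem hmem hcz hqlo
          (fun b hb => (hagree b hb).symm) fun b hb => ?_).symm
        rw [hzval] at hb
        rw [hval]
        exact hb.imp_right fun h' => ⟨h'.1, h'.2.trans h⟩
    rw [← heq, hval] at hdz
    exact hdz hdl
  · have hsub : insert c (s.val.filter (· < c)) ∪ Finset.Icc p' (p' + r) ⊆ z.val := by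
      intro b hb
      simp only [Finset.mem_union, Finset.mem_insert, Finset.mem_filter, Finset.mem_Icc] at hb
      rcases hb with (rfl | hb) | hb
      · exact hcz
      · exact (hc b hb.2).mpr hb.1
      · obtain ⟨i, rfl⟩ := Nat.exists_eq_add_of_le hb.1
        exact hp' i (by omega)
    have hle := Finset.card_le_card hsub
    rw [Finset.card_union_of_disjoint, Finset.card_insert_of_notMem (by simp),
      Nat.card_Icc] at hle
    · omega
    · rw [Finset.disjoint_left]
      intro b hb hb'
      simp only [Finset.mem_insert, Finset.mem_filter, Finset.mem_Icc] at hb hb'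
      omega

theorem endsInInterval_of_mem_cbDeriv (hf : ∀ x, m ≤ x → 1 ≤ f x)
    (hmono : ∀ x, m ≤ x → f x ≤ f (x + 1)) {A : Set (LexSpace (sizeByMin m f))} {r : ℕ}
    {s : LexSpace (sizeByMin m f)} (hs : s ∈ cbDeriv A (r : Ordinal.{0})) :
    EndsInInterval r s.val := by
  induction r generalizing s with
  | zero =>
    have hne := nonempty_of_mem_sizeByMin s.mem
    refine ⟨s.val.max' hne, fun i hi => ?_, fun y hy => s.val.le_max' y hy⟩
    obtain rfl := Nat.le_zero.mp hi
    exact s.val.max'_mem hne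
  | succ r ih =>
    rw [cbDeriv_natCast_succ] at hs
    by_contra hn
    obtain ⟨U, hU, h⟩ := exists_nhds_eq_of_endsInInterval hf hmono s (ih hs.1) hn
    obtain ⟨z, ⟨hzU, hzA⟩, hne⟩ := accPt_iff_nhds.mp (mem_derivedSet.mp hs.2) U hU
    exact hne (h z hzU (ih hzA))

-- Lower bound: points of high rank inside `M`

/-- The stem `u` is continued beyond `N` to a member inside `M` that ends in a run of length `r + 1`
whose predecessor `q` is also in `M`. That predecessor allows the construction to be repeated with
`u ∪ w` as stem. -/
theorem exists_extension_interval {M : Set ℕ} (hM : HasLongIntervals M) (hinf : M.Infinite)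
    {u : Finset ℕ} {x r : ℕ} (hx : x ∈ u) (hmin : ∀ y ∈ u, x ≤ y) (hm : m ≤ x)
    (huM : (u : Set ℕ) ⊆ M) (hc : u.card + (r + 1) ≤ f x) (N : ℕ) :
    ∃ w : Finset ℕ, (w : Set ℕ) ⊆ M ∧ (∀ y ∈ w, N ≤ y) ∧ (∀ y ∈ w, ∀ a ∈ u, a < y) ∧
      ∃ q ≥ N, q ∈ M ∧ (∀ y ∈ u ∪ w, y < q) ∧
        (u ∪ w) ∪ Finset.Icc (q + 1) (q + 1 + r) ∈ sizeByMin m f ∧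
        (((u ∪ w) ∪ Finset.Icc (q + 1) (q + 1 + r) : Finset ℕ) : Set ℕ) ⊆ M := by
  obtain ⟨B, hB⟩ := u.bddAbove
  -- `w` is padding: it uses up the elements that remain of the prescribed size `f x` after `u` and
  -- the final run.
  obtain ⟨w, hw, hwc⟩ := (hinf.sdiff (Set.finite_Iic (B + N))).exists_subset_card_eq
    (f x - u.card - (r + 1))
  have hwM : (w : Set ℕ) ⊆ M := fun y hy => (hw hy).1
  have hwB : ∀ y ∈ w, B + N < y := fun y hy => not_le.mp (hw hy).2
  have huB : ∀ y ∈ u, y ≤ B := fun y hy => hB hy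
  have huw : ∀ y ∈ w, ∀ a ∈ u, a < y := fun y hy a ha => by
    have := hwB y hy
    have := huB a ha
    omega
  obtain ⟨C, hC⟩ := (u ∪ w).bddAbove
  obtain ⟨q, hq, hqM⟩ := hM.exists_ge (r + 2) (C + N + 1)
  have hlt : ∀ y ∈ u ∪ w, y < q := fun y hy => by
    have : y ≤ C := hC hy
    omega
  refine ⟨w, hwM, fun y hy => by have := hwB y hy; omega, huw, q, by omega,
    hqM 0 (by omega), hlt, ⟨x, by simp [hx], ?_, hm, ?_⟩, ?_⟩
  · intro y hy
    simp only [Finset.mem_union, Finset.mem_Icc] at hy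
    rcases hy with (hy | hy) | hy
    · exact hmin y hy
    · exact (huw y hy x hx).le
    · have := hlt x (Finset.mem_union_left _ hx)
      omega
  · rw [Finset.card_union_of_disjoint, Finset.card_union_of_disjoint, Nat.card_Icc, hwc]
    · omega
    · rw [Finset.disjoint_left]
      exact fun y hy hy' => lt_irrefl y (huw y hy' y hy)
    · rw [Finset.disjoint_left]
      intro y hy hy'
      have := hlt y hy
      rw [Finset.mem_Icc] at hy'
      omega
  · intro y hy
    simp only [Finset.coe_union, Set.mem_union, Finset.mem_coe, Finset.mem_Icc] at hy
    rcases hy with (hy | hy) | hy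
    · exact huM hy
    · exact hwM hy
    · obtain ⟨i, rfl⟩ := Nat.exists_eq_add_of_le (show q ≤ y by omega)
      exact hqM i (by omega)

/-- In the lexicographic order `s` is the limit from below of members that start with `u ∪ {q}` and
continue ever further out. Trading part of the final run for `q` and padding costs one unit of rank.
-/
theorem mem_cbDeriv_of_eq_union_Icc {M : Set ℕ} (hM : HasLongIntervals M) (hinf : M.Infinite)
    {r : ℕ} {s : LexSpace (sizeByMin m f)} {u : Finset ℕ} {q j : ℕ} (hrj : r ≤ j)
    (hu : u.Nonempty) (huq : ∀ y ∈ u, y < q) (hqM : q ∈ M)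
    (hs : s.val = u ∪ Finset.Icc (q + 1) (q + 1 + j)) (hsM : (s.val : Set ℕ) ⊆ M) :
    s ∈ cbDeriv (restrict (sizeByMin m f) M) (r : Ordinal.{0}) := by
  induction r generalizing s u q j with
  | zero => simpa [cbDeriv_zero, restrict] using hsM
  | succ r ih =>
    rw [cbDeriv_natCast_succ]
    refine ⟨ih (by omega) hu huq hqM hs hsM, ?_⟩
    have hsval : ∀ b, b ∈ s.val ↔ b ∈ u ∨ (q + 1 ≤ b ∧ b ≤ q + 1 + j) := by
      intro b; rw [hs, Finset.mem_union, Finset.mem_Icc]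
    obtain ⟨x, hx, hmin⟩ := exists_least hu
    have hxs : x ∈ s.val := (hsval x).mpr (Or.inl hx)
    have hxq := huq x hx
    obtain ⟨hmx, hcs⟩ : m ≤ x ∧ s.val.card = f x := by
      obtain ⟨x', hx', hmin', hmx', hc'⟩ := s.mem
      have : x = x' := by
        refine le_antisymm ?_ (hmin' x hxs)
        rcases (hsval x').mp hx' with h | h
        · exact hmin x' h
        · omega
      subst this
      exact ⟨hmx', hc'⟩
    have hqu : q ∉ u := fun h => lt_irrefl q (huq q h)
    have hqs : q ∉ s.val := by
      rw [hsval]; rintro (h | h)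
      · exact hqu h
      · omega
    -- After adding `q` to the stem there is still room for a run of length `r + 1`, because `r + 1
    -- ≤ j`.
    have hcu : (insert q u).card + (r + 1) ≤ f x := by
      rw [← hcs, hs, Finset.card_union_of_disjoint, Nat.card_Icc, Finset.card_insert_of_notMem hqu]
      · omega
      · rw [Finset.disjoint_left]
        intro y hy hy'
        have := huq y hy
        rw [Finset.mem_Icc] at hy'
        omega
    have key : ∀ N, ∃ z ∈ cbDeriv (restrict (sizeByMin m f) M) (r : Ordinal.{0}),
        (∀ b ∈ z.val, b ∈ u ∨ b = q ∨ N ≤ b) ∧ q ∈ z.val ∧ ∀ b < q, (b ∈ z.val ↔ b ∈ u) := by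
      intro N
      obtain ⟨w, hwM, hwN, hwu, q', hq'N, hq'M, hlt, hmem, hsub⟩ :=
        exists_extension_interval hM hinf (u := insert q u) (x := x) (by simp [hx])
          (by
            intro y hy
            rcases Finset.mem_insert.mp hy with rfl | hy
            · exact hxq.le
            · exact hmin y hy) hmx
          (by
            intro y hy
            rcases Finset.mem_insert.mp hy with rfl | hy
            · exact hqM
            · exact hsM ((hsval y).mpr (Or.inl hy))) hcu N
      have hqq' : q < q' := hlt q (by simp)
      refine ⟨⟨_, hmem⟩, ih (u := insert q u ∪ w) le_rfl ⟨q, by simp⟩ hlt hq'M rfl hsub,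
        ?_, by simp, ?_⟩
      · intro b hb
        simp only [Finset.mem_union, Finset.mem_insert, Finset.mem_Icc] at hb
        rcases hb with ((hb | hb) | hb) | hb
        · exact Or.inr (Or.inl hb)
        · exact Or.inl hb
        · exact Or.inr (Or.inr (hwN b hb))
        · right; right; omega
      · intro b hb
        simp only [Finset.mem_union, Finset.mem_insert, Finset.mem_Icc]
        constructor
        · rintro (((h | h) | h) | h)
          · omega
          · exact h
          · have := hwu b h q (by simp)
            omega
          · omega
        · exact fun h => Or.inl (Or.inl (Or.inr h))
    have hlts : ∀ z : LexSpace (sizeByMin m f), q ∈ z.val → (∀ b < q, (b ∈ z.val ↔ b ∈ u)) →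
        z < s := by
      intro z hqz hz
      refine LexSpace.lt_iff.mpr ⟨q, hqz, hqs, fun b hb => ?_⟩
      rw [hz b hb, hsval]
      constructor
      · exact Or.inl
      · rintro (h | h)
        · exact h
        · omega
    rw [mem_derivedSet, accPt_iff_nhds]
    intro U hU
    obtain ⟨z₀, -, -, hqz₀, hz₀⟩ := key 0
    obtain ⟨l, hl, hlU⟩ := exists_Ioc_subset_of_mem_nhds hU ⟨z₀, hlts z₀ hqz₀ hz₀⟩
    obtain ⟨B, hB⟩ := l.val.bddAbove
    -- The bound puts every element of `z` outside `u ∪ {q}` beyond all elements of `l`, which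
    -- forces `l < z`.
    obtain ⟨z, hzA, hzN, hqz, hz⟩ := key (B + q + 1)
    have hzs := hlts z hqz hz
    refine ⟨z, ⟨hlU ⟨?_, hzs.le⟩, hzA⟩, hzs.ne⟩
    obtain ⟨c, hcl, hcs', hc⟩ := LexSpace.lt_iff.mp hl
    have hcB : c ≤ B := hB hcl
    rcases lt_trichotomy c q with hcq | rfl | hcq
    · refine LexSpace.lt_iff.mpr ⟨c, hcl, ?_, fun b hb => ?_⟩
      · rw [hz c hcq]
        exact fun h => hcs' ((hsval c).mpr (Or.inl h))
      · rw [hc b hb, hz b (hb.trans hcq), hsval]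
        constructor
        · rintro (h | h)
          · exact h
          · omega
        · exact Or.inl
    · have hagree : ∀ b < c, (b ∈ z.val ↔ b ∈ l.val) := by
        intro b hb
        rw [hz b hb, hc b hb, hsval]
        constructor
        · exact Or.inl
        · rintro (h | h)
          · exact h
          · omega
      rcases lt_trichotomy l z with h | h | h
      · exact h
      · subst h
        exfalso
        -- If `z = l`, then `z` has no elements outside `u ∪ {q}`, so it is too small.
        have hzeq : l.val ⊆ insert c u := by
          intro b hb
          rcases hzN b hb with h | h | h
          · simp [h]
          · simp [h]
          · have : b ≤ B := hB hb
            omega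
        have hle := Finset.card_le_card hzeq
        have hlc : l.val.card = s.val.card := by
          refine card_eq_of_agree (c := x) l.mem s.mem ((hz x hxq).mpr hx) hxs fun b hb => ?_
          exact hc b (hb.trans hxq)
        omega
      · exfalso
        obtain ⟨d, hdz, hdl, hd⟩ := LexSpace.lt_iff.mp h
        -- If `z < l`, they first differ beyond all of `l`, so `l` would be a proper initial segment
        -- of `z`.
        have hBd : B < d := by
          rcases hzN d hdz with h' | h' | h'
          · exact absurd ((hagree d (huq d h')).mp hdz) hdl
          · subst h'; exact absurd hcl hdl
          · omega
        have heq := eq_of_subset_of_agree l.mem z.mem hcl hqz (fun b hb => (hagree b hb).symm)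
          fun b hb => (hd b ((hB hb).trans_lt hBd)).mpr hb
        exact hdl (heq ▸ hdz)
    · exfalso
      have hjc : q + 1 + j < c := by
        by_contra h; exact hcs' ((hsval c).mpr (Or.inr ⟨hcq, by omega⟩))
      have heq := eq_of_subset_of_agree (c := x) s.mem l.mem hxs
        ((hc x (hxq.trans hcq)).mpr hxs) (fun b hb => (hc b (by omega)).symm)
        fun b hb => (hc b (by
          rcases (hsval b).mp hb with h | h
          · exact (huq b h).trans hcq
          · omega)).mpr hb
      exact hcs' (heq ▸ hcl)

/-- A finite set cannot end in runs of every length, so the `ω`-th derivative is empty and only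
nonemptiness of the finite derivatives is at stake. -/
theorem hasCBIndex_restrict_sizeByMin_iff (hf : ∀ x, m ≤ x → 1 ≤ f x)
    (hmono : ∀ x, m ≤ x → f x ≤ f (x + 1)) (hunb : ∀ n, ∃ N, ∀ x ≥ N, n ≤ f x)
    {M : Set ℕ} (hinf : M.Infinite) :
    HasCBIndex (restrict (sizeByMin m f) M) ω ↔ HasLongIntervals M := by
  rw [hasCBIndex_omega0_iff]
  · constructor
    · intro h n
      obtain ⟨s, hs⟩ := h n
      obtain ⟨p, hp, -⟩ := endsInInterval_of_mem_cbDeriv hf hmono hs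
      have hsM : (s.val : Set ℕ) ⊆ M := by
        have := cbDeriv_natCast_antitone (restrict (sizeByMin m f) M) (Nat.zero_le n) hs
        simpa [cbDeriv_zero, restrict] using this
      exact ⟨p, fun i hi => hsM (hp i hi.le)⟩
    · intro h r
      obtain ⟨N, hN⟩ := hunb (r + 2)
      obtain ⟨x, hxM, hx⟩ := hinf.exists_gt (m + N)
      have hfx := hN x (by omega)
      obtain ⟨w, -, -, -, q, -, hqM, hlt, hmem, hsub⟩ :=
        exists_extension_interval h hinf (u := {x}) (x := x) (r := r) (f := f) (m := m) (by simp)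
          (by simp) (by omega) (by simpa using hxM) (by rw [Finset.card_singleton]; omega) 0
      exact ⟨⟨_, hmem⟩, mem_cbDeriv_of_eq_union_Icc h hinf (u := {x} ∪ w) le_rfl ⟨x, by simp⟩
        hlt hqM rfl hsub⟩
  · rw [Set.eq_empty_iff_forall_notMem]
    intro s hs
    rw [mem_cbDeriv_omega0] at hs
    obtain ⟨B, hB⟩ := s.val.bddAbove
    obtain ⟨p, hp, -⟩ := endsInInterval_of_mem_cbDeriv hf hmono (hs (B + 1))
    have : p + (B + 1) ≤ B := hB (hp _ le_rfl)
    omega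

end SizeByMin

-- Reduction of `ω`-uniform families to size functions

theorem IsUniform.exists_eq_sizeByMin {m : ℕ} {F : Set (Finset ℕ)}
    (hF : IsUniform ω (Set.Ici m) F) :
    ∃ f : ℕ → ℕ, F = sizeByMin m f ∧ (∀ x, m ≤ x → 1 ≤ f x) ∧
      (∀ x, m ≤ x → f x ≤ f (x + 1)) ∧ ∀ n, ∃ N, ∀ x ≥ N, n ≤ f x := by
  obtain ⟨hsub, a, ha, hl⟩ := hF.of_isSuccLimit isSuccLimit_omega0
  -- Below `m` the ranks `a k` are unconstrained, so `b` takes the irrelevant value `0` there.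
  have hex : ∀ k, ∃ b : ℕ, m ≤ k → a k = b := by
    intro k
    by_cases hk : m ≤ k
    · obtain ⟨b, hb⟩ := lt_omega0.mp (ha.lt k hk)
      exact ⟨b, fun _ => hb⟩
    · exact ⟨0, fun h => absurd h hk⟩
  choose b hb using hex
  have hmono : ∀ x y, m ≤ x → x < y → b x < b y := by
    intro x y hx hxy
    have := ha.strictMono (show x ∈ Set.Ici m from hx)
      (show y ∈ Set.Ici m from hx.trans hxy.le) hxy
    rw [hb x hx, hb y (hx.trans hxy.le)] at this
    exact_mod_cast this
  refine ⟨fun k => b k + 1, eq_sizeByMin hsub fun k hk => hb k hk ▸ hl k hk, fun x _ => by simp,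
    fun x hx => ?_, fun n => ?_⟩
  · have := hmono x (x + 1) hx x.lt_succ_self
    dsimp only
    omega
  · obtain ⟨k, hk, hnk⟩ := ha.cofinal n (natCast_lt_omega0 n)
    rw [hb k hk] at hnk
    have hnk' : n < b k := by exact_mod_cast hnk
    refine ⟨k + 1, fun x hx => ?_⟩
    have := hmono k x hk (by omega)
    dsimp only
    omega

end UniformFamily

theorem mainTheorem2 (m : ℕ) (F : Set (Finset ℕ))
    (hF : UniformFamily.IsUniform ω (Set.Ici m) F) (M : Set ℕ) (hM : M.Infinite) :
    (UniformFamily.HasCBIndex (UniformFamily.restrict F M) ω ↔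
      UniformFamily.IsAdequate ω (Set.Ici m) F M) ∧
    (UniformFamily.IsAdequate ω (Set.Ici m) F M ↔ UniformFamily.HasLongIntervals M) := by
  have hiff := UniformFamily.isAdequate_omega0_iff hF hM
  refine ⟨?_, hiff⟩
  rw [hiff]
  obtain ⟨f, rfl, hf, hmono, hunb⟩ := hF.exists_eq_sizeByMin
  exact UniformFamily.hasCBIndex_restrict_sizeByMin_iff hf hmono hunb hM
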